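/- Let $z_1,\dots,z_n$ be distinct points of the open unit disk $\mathbb D$ and let $w_1,\dots,w_n\in\mathbb C$ satisfy $|w_i|<1$ for all $i$. The problem CNP asks for a holomorphic function $s:\mathbb D\to\overline{\mathbb D}$ with $s'(0)=0$ and $s(z_i)=w_i$ for $i=1,\dots,n$. Put $$P=\Big[\tfrac{1-w_i\overline{w_j}}{1-z_i\overline{z_j}}\Big]_{i,j=1}^n,\quad Z=\operatorname{diag}(z_1,\dots,z_n),\quad E=(1,\dots,1)^{\top},\quad W=(w_1,\dots,w_n)^{\top},$$ and for $x\in\mathbb C$ let $$P_x=\begin{bmatrix} P & E-W\overline{x} & Z(E-W\overline{x}) & 0&0\\ E^*-xW^* & 1&0&x&0\\ (E^*-xW^*)Z^*&0&1&0&x\\ 0&\overline{x}&0&1&0\\ 0&0&\overline{x}&0&1\end{bmatrix}.$$ Assume that $\Delta=P+WW^*+ZWW^*Z^*$ is positive definite, and set $$\widetilde\Delta=P-EE^*-ZEE^*Z^*+(WE^*+ZWE^*Z^*)\,\Delta^{-1}\,(EW^*+ZEW^*Z^*).$$ When $\widetilde\Delta$ is positive semidefinite, consider, for $n\times n$ matrices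 $K$, $$(\ast)\qquad \Delta^{-1}(EW^*+ZEW^*Z^*)+\Delta^{-1/2}K\,\widetilde\Delta^{1/2}.$$ A matrix is contractive (strictly contractive) if its operator norm on Euclidean $\mathbb C^n$ is at most $1$ (less than $1$). Then: (a) CNP has a solution if and only if (1) $\widetilde\Delta$ is positive semidefinite and (2) there is a contractive $n\times n$ matrix $K$ for which $(\ast)$ is a scalar multiple of $I_n$. (b) If $\widetilde\Delta$ is positive semidefinite and $x\in\mathbb D$, then $P_x$ is positive semidefinite if and only if $\overline{x}I_n$ is of the form $(\ast)$ for some contractive $K$. (c) If $P_x$ is positive definite for some $x\in\mathbb D$, then $\widetilde\Delta$ is positive definite. (d) If $\widetilde\Delta$ is positive definite and $x\in\mathbb D$, then $P_x$ is positive definite if and only if $\overline{x}I_n$ is of the form $(\ast)$ for some strictly contractive $K$. -/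

import Mathlib

open scoped ComplexOrder

noncomputable section

open Matrix
open scoped MatrixOrder ComplexConjugate

namespace CNP

/-- `s` belongs to the constrained Schur class: it is holomorphic on the open unit disk, maps it
into the closed unit disk, and satisfies `s'(0) = 0`. (Values of `s` off the disk are
irrelevant; the derivative at `0` is the honest one since `s` is holomorphic near `0`.) -/
def ConstrainedSchur (s : ℂ → ℂ) : Prop :=
  DifferentiableOn ℂ s (Metric.ball 0 1) ∧
    (∀ ζ ∈ Metric.ball (0 : ℂ) 1, ‖s ζ‖ ≤ 1) ∧ deriv s 0 = 0

/-- The constrained Nevanlinna-Pick problem with nodes `z` and values `w` has a solution. -/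
def Solvable {n : ℕ} (z w : Fin n → ℂ) : Prop :=
  ∃ s : ℂ → ℂ, ConstrainedSchur s ∧ ∀ i, s (z i) = w i

/-- The diagonal matrix `Z = diag(z₁, …, zₙ)`. -/
def matZ {n : ℕ} (z : Fin n → ℂ) : Matrix (Fin n) (Fin n) ℂ := diagonal z

/-- The column `E` all of whose `n` entries are `1`. -/
def colE (n : ℕ) : Matrix (Fin n) (Fin 1) ℂ := of fun _ _ => 1

/-- The column `W` with entries `w₁, …, wₙ`. -/
def colW {n : ℕ} (w : Fin n → ℂ) : Matrix (Fin n) (Fin 1) ℂ := of fun i _ => w i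

/-- The classical Pick matrix `P`. -/
def pick {n : ℕ} (z w : Fin n → ℂ) : Matrix (Fin n) (Fin n) ℂ :=
  of fun i j => (1 - w i * conj (w j)) / (1 - z i * conj (z j))

/-- `Δ = P + W W* + Z W W* Z*`. -/
def Delta {n : ℕ} (z w : Fin n → ℂ) : Matrix (Fin n) (Fin n) ℂ :=
  pick z w + colW w * (colW w)ᴴ + matZ z * colW w * (colW w)ᴴ * (matZ z)ᴴ

/-- `E W* + Z E W* Z*`. -/
def crossEW {n : ℕ} (z w : Fin n → ℂ) : Matrix (Fin n) (Fin n) ℂ :=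
  colE n * (colW w)ᴴ + matZ z * colE n * (colW w)ᴴ * (matZ z)ᴴ

/-- `W E* + Z W E* Z*`. -/
def crossWE {n : ℕ} (z w : Fin n → ℂ) : Matrix (Fin n) (Fin n) ℂ :=
  colW w * (colE n)ᴴ + matZ z * colW w * (colE n)ᴴ * (matZ z)ᴴ

/-- `Δ̃ = P - E E* - Z E E* Z* + (W E* + Z W E* Z*) Δ⁻¹ (E W* + Z E W* Z*)`. -/
def DeltaTilde {n : ℕ} (z w : Fin n → ℂ) : Matrix (Fin n) (Fin n) ℂ :=
  pick z w - colE n * (colE n)ᴴ - matZ z * colE n * (colE n)ᴴ * (matZ z)ᴴ +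
    crossWE z w * (Delta z w)⁻¹ * crossEW z w

/-- `Δ⁻¹ (E W* + Z E W* Z*) + Δ^(-1/2) K Δ̃^(1/2)`, where the square roots are the positive
semidefinite ones (so this is meaningful for `Δ` positive definite and `Δ̃` positive
semidefinite). -/
def ballPoint {n : ℕ} (z w : Fin n → ℂ) (K : Matrix (Fin n) (Fin n) ℂ) :
    Matrix (Fin n) (Fin n) ℂ :=
  (Delta z w)⁻¹ * crossEW z w + (CFC.sqrt (Delta z w))⁻¹ * K * CFC.sqrt (DeltaTilde z w)

/-- The operator norm of a square matrix acting on Euclidean space `ℂⁿ`. -/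
def opNorm {n : ℕ} (K : Matrix (Fin n) (Fin n) ℂ) : ℝ :=
  ‖Matrix.toEuclideanCLM (n := Fin n) (𝕜 := ℂ) K‖

/-- The Pick matrix with free parameter `x`, that is, with `X = [x]`,
```
  P             E - W X*   Z (E - W X*)   0    0
  E* - X W*     1          0              X    0
  (E* - X W*)Z* 0          1              0    X
  0             X*         0              1    0
  0             0          X*             0    1
```
The first three block rows and columns are grouped together, and so are the last two. -/
def pickX {n : ℕ} (z w : Fin n → ℂ) (x : ℂ) :
    Matrix ((Fin n ⊕ (Fin 1 ⊕ Fin 1)) ⊕ (Fin 1 ⊕ Fin 1))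
      ((Fin n ⊕ (Fin 1 ⊕ Fin 1)) ⊕ (Fin 1 ⊕ Fin 1)) ℂ :=
  let X : Matrix (Fin 1) (Fin 1) ℂ := of fun _ _ => x
  fromBlocks
    (fromBlocks
      (pick z w)
      (fromCols (colE n - colW w * Xᴴ) (matZ z * (colE n - colW w * Xᴴ)))
      (fromRows ((colE n)ᴴ - X * (colW w)ᴴ) (((colE n)ᴴ - X * (colW w)ᴴ) * (matZ z)ᴴ))
      (fromBlocks 1 0 0 1))
    (fromRows 0 (fromBlocks X 0 0 X))
    (fromCols 0 (fromBlocks Xᴴ 0 0 Xᴴ))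
    (fromBlocks 1 0 0 1)

end CNP

end

open scoped ComplexOrder
open Matrix
open scoped MatrixOrder ComplexConjugate

namespace CNP

/-! Fix the value `x = s 0`, with `|x| < 1`. A Schur function `s` has `s(0) = x` and `s'(0) = 0`
exactly when `(s - x) / (1 - x̄ s) = ζ² g` for a Schur function `g`. The conditions `s(zᵢ) = wᵢ`
become the tangential conditions `zᵢ² (1 - x̄ wᵢ) g(zᵢ) = wᵢ - x`, whose Pick matrix is `gap z w x`.
The tangential Nevanlinna-Pick theorem, proved by the Schur algorithm, then makes CNP equivalent to
`gap z w x` being positive semidefinite for some `x` (`solvable_iff_exists_gap`).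

The rest is matrix algebra. Two Schur complements in `P_x` leave `gap z w x` up to the factor `1 -
|x|²` (`pickX_posSemidef_iff`). Completing the square in `x̄` gives `gap = Δ̃ - Tᴴ Δ T` with `T = x̄
I - Δ⁻¹ (E W* + Z E W* Z*)` (`DeltaTilde_sub_eq_gap`). Hence positivity of `gap` forces that of
`Δ̃`, and by Douglas factorization it means `Δ^(1/2) T = K Δ̃^(1/2)` with `K` contractive, which is
`(∗)` solved for `x̄ I`. The strict versions run in parallel. -/

/-! ### Schur functions and division by a Blaschke factor. -/

/-- The Schur class: holomorphic self-maps of the unit disk, with values in the closed disk. -/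
def IsSchur (g : ℂ → ℂ) : Prop :=
  DifferentiableOn ℂ g (Metric.ball 0 1) ∧ ∀ ζ ∈ Metric.ball (0 : ℂ) 1, ‖g ζ‖ ≤ 1

theorem normSq_moebius (a u : ℂ) :
    ‖1 - conj a * u‖ ^ 2 - ‖u - a‖ ^ 2 = (1 - ‖a‖ ^ 2) * (1 - ‖u‖ ^ 2) := by
  simp only [Complex.sq_norm, Complex.normSq_apply, Complex.sub_re, Complex.sub_im, Complex.mul_re,
    Complex.mul_im, Complex.one_re, Complex.one_im, Complex.conj_re, Complex.conj_im]
  ring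

theorem one_sub_conj_mul_ne_zero {a u : ℂ} (ha : ‖a‖ < 1) (hu : ‖u‖ ≤ 1) :
    1 - conj a * u ≠ 0 := by
  intro h
  have h1 : ‖conj a * u‖ = 1 := by rw [← sub_eq_zero.1 h]; simp
  rw [norm_mul, RCLike.norm_conj] at h1
  nlinarith [norm_nonneg a, norm_nonneg u]

theorem norm_moebius_le {a u : ℂ} (ha : ‖a‖ < 1) (hu : ‖u‖ ≤ 1) :
    ‖(u - a) / (1 - conj a * u)‖ ≤ 1 := by
  rw [norm_div]
  refine div_le_one_of_le₀ ?_ (norm_nonneg _)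
  have h := normSq_moebius a u
  have : 0 ≤ (1 - ‖a‖ ^ 2) * (1 - ‖u‖ ^ 2) :=
    mul_nonneg (by nlinarith [norm_nonneg a]) (by nlinarith [norm_nonneg u])
  exact (sq_le_sq₀ (norm_nonneg _) (norm_nonneg _)).1 (by linarith)

theorem norm_moebius_lt {a u : ℂ} (ha : ‖a‖ < 1) (hu : ‖u‖ < 1) :
    ‖(u - a) / (1 - conj a * u)‖ < 1 := by
  rw [norm_div, div_lt_one (norm_pos_iff.2 (one_sub_conj_mul_ne_zero ha hu.le))]
  have h := normSq_moebius a u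
  have : 0 < (1 - ‖a‖ ^ 2) * (1 - ‖u‖ ^ 2) :=
    mul_pos (by nlinarith [norm_nonneg a]) (by nlinarith [norm_nonneg u])
  exact (sq_lt_sq₀ (norm_nonneg _) (norm_nonneg _)).1 (by linarith)

namespace IsSchur

theorem moebius {g : ℂ → ℂ} (hg : IsSchur g) {a : ℂ} (ha : ‖a‖ < 1) :
    IsSchur fun ζ => (g ζ - a) / (1 - conj a * g ζ) :=
  ⟨(hg.1.sub_const a).fun_div ((hg.1.const_mul _).const_sub _) fun ζ hζ =>
    one_sub_conj_mul_ne_zero ha (hg.2 ζ hζ), fun ζ hζ => norm_moebius_le ha (hg.2 ζ hζ)⟩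

theorem mul {g h : ℂ → ℂ} (hg : IsSchur g) (hh : IsSchur h) : IsSchur fun ζ => g ζ * h ζ :=
  ⟨hg.1.fun_mul hh.1, fun ζ hζ => by
    rw [norm_mul]; exact mul_le_one₀ (hg.2 ζ hζ) (norm_nonneg _) (hh.2 ζ hζ)⟩

theorem id : IsSchur fun ζ => ζ :=
  ⟨differentiableOn_id, fun _ hζ => (mem_ball_zero_iff.1 hζ).le⟩

theorem const {c : ℂ} (hc : ‖c‖ ≤ 1) : IsSchur fun _ => c :=
  ⟨differentiableOn_const c, fun _ _ => hc⟩

theorem comp {g h : ℂ → ℂ} (hg : IsSchur g) (hh : IsSchur h)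
    (hlt : ∀ ζ ∈ Metric.ball (0 : ℂ) 1, ‖h ζ‖ < 1) : IsSchur fun ζ => g (h ζ) :=
  ⟨hg.1.fun_comp hh.1 fun ζ hζ => mem_ball_zero_iff.2 (hlt ζ hζ),
    fun ζ hζ => hg.2 _ (mem_ball_zero_iff.2 (hlt ζ hζ))⟩

theorem dslope {g : ℂ → ℂ} (hg : IsSchur g) (h0 : g 0 = 0) : IsSchur (dslope g 0) := by
  refine ⟨(Complex.differentiableOn_dslope (Metric.ball_mem_nhds _ one_pos)).2 hg.1, fun ζ hζ => ?_⟩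
  have := Complex.norm_dslope_le_div_of_mapsTo_ball (R₂ := 1) hg.1 (fun ξ hξ => by
    rw [h0]; exact mem_closedBall_zero_iff.2 (hg.2 ξ hξ)) hζ
  simpa using this

/-- A Schur function attaining modulus one inside the disk is constant. -/
theorem eq_const {g : ℂ → ℂ} (hg : IsSchur g) {a : ℂ} (ha : ‖a‖ < 1) (h : 1 ≤ ‖g a‖)
    {ζ : ℂ} (hζ : ‖ζ‖ < 1) : g ζ = g a :=
  Complex.eqOn_of_isPreconnected_of_isMaxOn_norm (convex_ball (0 : ℂ) 1).isPreconnected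
    Metric.isOpen_ball hg.1 (mem_ball_zero_iff.2 ha)
    (fun ξ hξ => (hg.2 ξ hξ).trans h) (mem_ball_zero_iff.2 hζ)

/-- One step of the Schur algorithm at the point `a`. -/
theorem exists_division {g : ℂ → ℂ} (hg : IsSchur g) {a : ℂ} (ha : ‖a‖ < 1) (h : ‖g a‖ < 1) :
    ∃ f, IsSchur f ∧ ∀ ζ : ℂ, ‖ζ‖ < 1 →
      g ζ - g a = (1 - conj (g a) * g ζ) * ((ζ - a) / (1 - conj a * ζ)) * f ζ := by
  have ha' : ‖-a‖ < 1 := by rwa [norm_neg]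
  -- Conjugating by disk automorphisms on both sides moves the pair `(a, g a)` to `(0, 0)`, where
  -- the Schwarz lemma allows division by `ξ`.
  have hp : IsSchur fun ξ => (g ((ξ - -a) / (1 - conj (-a) * ξ)) - g a) /
      (1 - conj (g a) * g ((ξ - -a) / (1 - conj (-a) * ξ))) :=
    (hg.comp (IsSchur.id.moebius ha') fun ζ hζ =>
      norm_moebius_lt ha' (mem_ball_zero_iff.1 hζ)).moebius h
  refine ⟨_, (hp.dslope (by simp)).comp (IsSchur.id.moebius ha) fun ζ hζ =>
    norm_moebius_lt ha (mem_ball_zero_iff.1 hζ), fun ζ hζ => ?_⟩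
  have hd := sub_smul_dslope (fun ξ => (g ((ξ - -a) / (1 - conj (-a) * ξ)) - g a) /
      (1 - conj (g a) * g ((ξ - -a) / (1 - conj (-a) * ξ)))) 0 ((ζ - a) / (1 - conj a * ζ))
  have h1 := one_sub_conj_mul_ne_zero ha hζ.le
  have h1' : 1 - ζ * conj a ≠ 0 := by rwa [mul_comm]
  have h2 := one_sub_conj_mul_ne_zero ha ha.le
  have hinv : ((ζ - a) / (1 - conj a * ζ) - -a) /
      (1 - conj (-a) * ((ζ - a) / (1 - conj a * ζ))) = ζ := by
    have h3 : (1 - conj (-a) * ((ζ - a) / (1 - conj a * ζ))) =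
        (1 - conj a * a) / (1 - conj a * ζ) := by
      rw [map_neg]; field_simp; ring
    have h5 : (ζ - a) / (1 - conj a * ζ) - -a = ζ * (1 - conj a * a) / (1 - conj a * ζ) := by
      field_simp; ring
    rw [h3, h5, div_div_div_cancel_right₀ h1, mul_div_cancel_right₀ _ h2]
  simp only [smul_eq_mul, sub_zero] at hd
  rw [mul_assoc, hd, hinv]
  have h4 : 1 - g ζ * conj (g a) ≠ 0 := by
    rw [mul_comm]; exact one_sub_conj_mul_ne_zero h (hg.2 ζ (mem_ball_zero_iff.2 hζ))
  simp only [sub_neg_eq_add, zero_add, map_neg, mul_zero, sub_zero, div_one, sub_self, zero_div]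
  field_simp

end IsSchur

/-! ### The tangential Nevanlinna-Pick theorem. -/

theorem posSemidef_succ_iff {n : ℕ} {M : Matrix (Fin (n + 1)) (Fin (n + 1)) ℂ}
    (hM : M.IsHermitian) (h0 : 0 < M 0 0) :
    M.PosSemidef ↔ (of fun i j : Fin n =>
      M i.succ j.succ - M i.succ 0 * M 0 j.succ / M 0 0).PosSemidef := by
  have hbij : Function.Bijective (Sum.elim (fun _ => 0) Fin.succ : Fin 1 ⊕ Fin n → Fin (n + 1)) := by
    constructor
    · rintro (i | i) (j | j) h
      · rw [Subsingleton.elim i j]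
      · exact absurd h.symm (Fin.succ_ne_zero j)
      · exact absurd h (Fin.succ_ne_zero i)
      · rw [Fin.succ_injective n h]
    · intro i
      refine Fin.cases ⟨Sum.inl 0, rfl⟩ (fun j => ⟨Sum.inr j, rfl⟩) i
  rw [← posSemidef_submatrix_equiv (Equiv.ofBijective _ hbij)]
  obtain ⟨A, hA⟩ : ∃ A : Matrix (Fin 1) (Fin 1) ℂ, A = diagonal fun _ => M 0 0 := ⟨_, rfl⟩
  obtain ⟨B, hB⟩ : ∃ B : Matrix (Fin 1) (Fin n) ℂ, B = of fun _ j => M 0 j.succ := ⟨_, rfl⟩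
  obtain ⟨D, hD⟩ : ∃ D : Matrix (Fin n) (Fin n) ℂ, D = of fun i j => M i.succ j.succ := ⟨_, rfl⟩
  have hApd : A.PosDef := by
    rw [hA]; exact PosDef.diagonal fun _ => h0
  have hinv : A⁻¹ = diagonal fun _ => (M 0 0)⁻¹ := by
    rw [inv_subsingleton, hA]; simp
  have : Invertible A := hApd.isUnit.invertible
  have h1 : M.submatrix (Equiv.ofBijective _ hbij) (Equiv.ofBijective _ hbij) =
      fromBlocks A B Bᴴ D := by
    ext (i | i) (j | j)
    · simp [hA, Subsingleton.elim i j]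
    · simp [hB]
    · simpa [hB] using (hM.apply i.succ 0).symm
    · simp [hD]
  have h2 : (of fun i j : Fin n => M i.succ j.succ - M i.succ 0 * M 0 j.succ / M 0 0) =
      D - Bᴴ * A⁻¹ * B := by
    rw [hinv, hB, hD]
    ext i j
    simp only [of_apply, Matrix.sub_apply, Matrix.mul_apply, conjTranspose_apply,
      hM.apply, Finset.univ_unique, Finset.sum_singleton]
    rw [diagonal_apply_eq]
    ring
  rw [h1, h2]
  exact PosDef.fromBlocks₁₁ B D hApd

/-- The Pick matrix of the left tangential interpolation problem `aᵢ g(zᵢ) = bᵢ`. -/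
noncomputable def tangentialPick {n : ℕ} (z a b : Fin n → ℂ) : Matrix (Fin n) (Fin n) ℂ :=
  of fun i j => (a i * conj (a j) - b i * conj (b j)) / (1 - z i * conj (z j))

theorem isHermitian_tangentialPick {n : ℕ} (z a b : Fin n → ℂ) :
    (tangentialPick z a b).IsHermitian := by
  ext i j
  simp [tangentialPick, mul_comm]

/-- Scaling the interpolation conditions one by one acts on the Pick matrix as a congruence, which
preserves positivity. -/
theorem tangentialPick_mul {n : ℕ} (z a b d : Fin n → ℂ) :
    tangentialPick z (fun i => d i * a i) (fun i => d i * b i) =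
      diagonal d * tangentialPick z a b * (diagonal d)ᴴ := by
  ext i j
  simp [tangentialPick, diagonal_conjTranspose, mul_diagonal, diagonal_mul]
  ring

theorem one_sub_mul_conj_ne_zero {a u : ℂ} (ha : ‖a‖ < 1) (hu : ‖u‖ < 1) :
    1 - u * conj a ≠ 0 := by
  rw [mul_comm]; exact one_sub_conj_mul_ne_zero ha hu.le

theorem one_sub_mul_conj_self_pos {a : ℂ} (ha : ‖a‖ < 1) : 0 < 1 - a * conj a := by
  rw [Complex.mul_conj', sub_pos]
  exact_mod_cast pow_lt_one₀ (norm_nonneg a) ha two_ne_zero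

theorem tangentialPick_apply_self_pos {n : ℕ} {z a b : Fin n → ℂ} {i : Fin n} {v : ℂ}
    (hz : ‖z i‖ < 1) (ha : a i ≠ 0) (hb : b i = a i * v) (hv : ‖v‖ < 1) :
    0 < tangentialPick z a b i i := by
  have : tangentialPick z a b i i =
      (a i * conj (a i)) * (1 - v * conj v) * (1 - z i * conj (z i))⁻¹ := by
    simp [tangentialPick, hb, div_eq_mul_inv]; left; ring
  rw [this]
  have h1 : 0 < a i * conj (a i) := by
    rw [Complex.mul_conj]; exact_mod_cast Complex.normSq_pos.2 ha
  exact mul_pos (mul_pos h1 (one_sub_mul_conj_self_pos hv))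
    (inv_pos.2 (one_sub_mul_conj_self_pos hz))

/-- Primed letters play the role of conjugates but are treated as independent variables, so the
identity is purely one of rational functions. -/
theorem schur_algorithm_identity {𝕜 : Type*} [Field 𝕜]
    {a a' a₀ a₀' b b' v v' z z' z₀ z₀' : 𝕜} (h1 : 1 - z * z' ≠ 0)
    (h2 : 1 - z * z₀' ≠ 0) (h3 : 1 - z₀ * z' ≠ 0) (h5 : 1 - v * v' ≠ 0)
    (ha : a₀ ≠ 0) (ha' : a₀' ≠ 0) :
    ((a - v' * b) * ((z - z₀) / (1 - z₀' * z)) * ((a' - v * b') * ((z' - z₀') / (1 - z₀ * z'))) -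
      (b - v * a) * (b' - v' * a')) / (1 - z * z') =
    (1 - v * v') * ((a * a' - b * b') / (1 - z * z') -
      (a * a₀' - b * (a₀' * v')) / (1 - z * z₀') * ((a₀ * a' - a₀ * v * b') / (1 - z₀ * z')) /
        ((a₀ * a₀' - a₀ * v * (a₀' * v')) / (1 - z₀ * z₀'))) := by
  have h6 : a₀ * a₀' - a₀ * v * (a₀' * v') = a₀ * a₀' * (1 - v * v') := by ring
  have h7 : 1 - z₀' * z = 1 - z * z₀' := by ring
  have h5' : 1 - v' * v ≠ 0 := by rwa [mul_comm]
  rw [h6, h7]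
  field_simp
  ring

/-- The Schur complement of the first diagonal entry of a tangential Pick matrix is, up to a
positive factor, the tangential Pick matrix of the data after one step of the Schur algorithm. -/
theorem posSemidef_tangentialPick_succ_iff {n : ℕ} {z a b : Fin (n + 1) → ℂ} {v : ℂ}
    (hz : ∀ i, ‖z i‖ < 1) (ha : a 0 ≠ 0) (hb : b 0 = a 0 * v) (hv : ‖v‖ < 1) :
    (tangentialPick z a b).PosSemidef ↔ (tangentialPick (fun i : Fin n => z i.succ)
      (fun i => (a i.succ - conj v * b i.succ) * ((z i.succ - z 0) / (1 - conj (z 0) * z i.succ)))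
      (fun i => b i.succ - v * a i.succ)).PosSemidef := by
  rw [posSemidef_succ_iff (isHermitian_tangentialPick z a b)
    (tangentialPick_apply_self_pos (hz 0) ha hb hv)]
  have hpos := one_sub_mul_conj_self_pos hv
  have key : (tangentialPick (fun i : Fin n => z i.succ)
      (fun i => (a i.succ - conj v * b i.succ) * ((z i.succ - z 0) / (1 - conj (z 0) * z i.succ)))
      (fun i => b i.succ - v * a i.succ)) = (1 - v * conj v) • (of fun i j : Fin n =>
      tangentialPick z a b i.succ j.succ - tangentialPick z a b i.succ 0 *
        tangentialPick z a b 0 j.succ / tangentialPick z a b 0 0) := by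
    ext i j
    have h1 := one_sub_mul_conj_ne_zero (hz j.succ) (hz i.succ)
    have h2 := one_sub_mul_conj_ne_zero (hz 0) (hz i.succ)
    have h3 := one_sub_mul_conj_ne_zero (hz j.succ) (hz 0)
    have ha' : conj (a 0) ≠ 0 := by simpa using ha
    simp only [tangentialPick, of_apply, Matrix.smul_apply, smul_eq_mul, hb, map_mul, map_sub, map_div₀,
      Complex.conj_conj, map_one]
    exact schur_algorithm_identity h1 h2 h3 hpos.ne' ha ha'
  constructor
  · intro h
    rw [key]; exact h.smul hpos.le
  · intro h
    have := h.smul (inv_pos.2 hpos).le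
    rwa [key, inv_smul_smul₀ hpos.ne'] at this

/-- Induction on the number of nodes: one Schur step replaces `g` by its quotient `f` and drops the
first node. If `|g|` reaches `1`, then `g` is a unimodular constant and the matrix vanishes. -/
theorem IsSchur.posSemidef_tangentialPick_one {n : ℕ} : ∀ {z : Fin n → ℂ} {g : ℂ → ℂ},
    IsSchur g → (∀ i, ‖z i‖ < 1) →
      (tangentialPick z (fun _ => 1) (fun i => g (z i))).PosSemidef := by
  induction n with
  | zero =>
    intro z g _ _
    rw [Subsingleton.elim (tangentialPick z (fun _ => 1) (fun i => g (z i))) 0]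
    exact PosSemidef.zero
  | succ n ih =>
    intro z g hg hz
    rcases lt_or_ge ‖g (z 0)‖ 1 with h | h
    · rw [posSemidef_tangentialPick_succ_iff hz one_ne_zero (one_mul _).symm h]
      obtain ⟨f, hf, hfg⟩ := hg.exists_division (hz 0) h
      -- This scaling turns the data `(1, f(zᵢ))` into the reduced data, since `g - g(z₀)` is the
      -- scaling factor times `f`.
      have := (ih hf fun i : Fin n => hz i.succ).mul_mul_conjTranspose_same
        (diagonal fun i : Fin n => (1 - conj (g (z 0)) * g (z i.succ)) *
          ((z i.succ - z 0) / (1 - conj (z 0) * z i.succ)))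
      rw [← tangentialPick_mul] at this
      simpa [hfg _ (hz _)] using this
    · have h1 : ‖g (z 0)‖ = 1 := le_antisymm (hg.2 _ (mem_ball_zero_iff.2 (hz 0))) h
      have : tangentialPick z (fun _ => 1) (fun i => g (z i)) = 0 := by
        ext i j
        simp [tangentialPick, hg.eq_const (hz 0) h (hz _), Complex.mul_conj', h1]
      rw [this]
      exact PosSemidef.zero

/-- Necessity in the tangential Nevanlinna-Pick theorem. -/
theorem IsSchur.posSemidef_tangentialPick {n : ℕ} {z a b : Fin n → ℂ} {g : ℂ → ℂ}
    (hg : IsSchur g) (hz : ∀ i, ‖z i‖ < 1) (hb : ∀ i, b i = a i * g (z i)) :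
    (tangentialPick z a b).PosSemidef := by
  have := (hg.posSemidef_tangentialPick_one hz).mul_mul_conjTranspose_same (diagonal a)
  rw [← tangentialPick_mul] at this
  simpa [← hb] using this

theorem norm_le_of_posSemidef_tangentialPick {n : ℕ} {z a b : Fin n → ℂ} {i : Fin n}
    (hz : ‖z i‖ < 1) (h : (tangentialPick z a b).PosSemidef) : ‖b i‖ ≤ ‖a i‖ := by
  have h1 := h.diag_nonneg (i := i)
  have h2 := one_sub_mul_conj_self_pos hz
  have h3 : a i * conj (a i) - b i * conj (b i) =
      tangentialPick z a b i i * (1 - z i * conj (z i)) := by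
    simp [tangentialPick, h2.ne']
  have h4 : 0 ≤ a i * conj (a i) - b i * conj (b i) := h3 ▸ mul_nonneg h1 h2.le
  rw [Complex.mul_conj', Complex.mul_conj', sub_nonneg] at h4
  exact (sq_le_sq₀ (norm_nonneg _) (norm_nonneg _)).1 (by exact_mod_cast h4)

/-- Sufficiency in the tangential Nevanlinna-Pick theorem. -/
theorem exists_isSchur_of_posSemidef_tangentialPick {n : ℕ} : ∀ {z a b : Fin n → ℂ},
    (∀ i, ‖z i‖ < 1) → (tangentialPick z a b).PosSemidef →
      ∃ g, IsSchur g ∧ ∀ i, b i = a i * g (z i) := by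
  induction n with
  | zero => exact fun _ _ => ⟨fun _ => 0, IsSchur.const (by simp), fun i => i.elim0⟩
  | succ n ih =>
    intro z a b hz h
    have hle := norm_le_of_posSemidef_tangentialPick (hz 0) h
    by_cases ha : a 0 = 0
    · obtain ⟨g, hg, hgb⟩ := ih (fun i => hz i.succ) (h.submatrix Fin.succ)
      refine ⟨g, hg, Fin.cases ?_ hgb⟩
      rw [ha, norm_zero] at hle
      rw [ha, zero_mul, norm_le_zero_iff.1 hle]
    obtain ⟨v, hv⟩ : ∃ v, b 0 = a 0 * v := ⟨b 0 / a 0, by field_simp⟩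
    have hv1 : ‖v‖ ≤ 1 := by
      rw [hv, norm_mul] at hle
      exact le_of_mul_le_mul_left (by linarith) (norm_pos_iff.2 ha)
    rcases hv1.lt_or_eq with hv1 | hv1
    · rw [posSemidef_tangentialPick_succ_iff hz ha hv hv1] at h
      obtain ⟨f, hf, hfb⟩ := ih (fun i => hz i.succ) h
      -- Reversing the Schur step: with `φ` the Blaschke factor at `z 0`, the solution is `(φ f + v)
      -- / (1 + v̄ φ f)`.
      have hs := (IsSchur.id.moebius (hz 0)).mul hf
      have hs' := hs.moebius (a := -v) (by rwa [norm_neg])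
      refine ⟨_, hs', fun i => ?_⟩
      have hne := one_sub_conj_mul_ne_zero (a := -v) (by rwa [norm_neg])
        (hs.2 _ (mem_ball_zero_iff.2 (hz i)))
      rw [mul_div_assoc', eq_div_iff hne, map_neg]
      refine Fin.cases ?_ (fun j => ?_) i
      · rw [hv]; ring
      · linear_combination hfb j
    -- Here `|v| = 1`: the first diagonal entry is zero, so positivity kills the whole first column,
    -- and this forces `bᵢ = aᵢ v`.
    · refine ⟨fun _ => v, IsSchur.const hv1.le, fun i => ?_⟩
      have hvv : v * conj v = 1 := by rw [Complex.mul_conj', hv1]; simp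
      have h00 : tangentialPick z a b 0 0 = 0 := by
        simp only [tangentialPick, of_apply, hv, map_mul, div_eq_zero_iff]
        left; linear_combination -(a 0 * conj (a 0)) * hvv
      have hi0 : tangentialPick z a b i 0 = 0 := by
        have h0 : tangentialPick z a b *ᵥ Pi.single 0 1 = 0 :=
          (h.dotProduct_mulVec_zero_iff _).1 (by
            rw [mulVec_single_one]; simp [Pi.star_single, single_dotProduct, h00])
        rw [mulVec_single_one] at h0
        exact congrFun h0 i
      simp only [tangentialPick, of_apply, hv, map_mul, div_eq_zero_iff,
        one_sub_mul_conj_ne_zero (hz 0) (hz i), or_false] at hi0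
      have ha' : conj (a 0) ≠ 0 := by simpa using ha
      have : conj (a 0) * (b i - a i * v) = 0 := by
        linear_combination -v * hi0 - b i * conj (a 0) * hvv
      exact sub_eq_zero.1 ((mul_eq_zero.1 this).resolve_left ha')

/-! ### Schur complements and Douglas factorization. -/

/-- A positive semidefinite matrix is definite when its determinant is nonzero, and the block
determinant is `det D` times that of the Schur complement. -/
theorem posDef_fromBlocks₂₂_iff {m n : Type*} [Fintype m] [DecidableEq m] [Fintype n]
    [DecidableEq n] (A : Matrix m m ℂ) (B : Matrix m n ℂ) {D : Matrix n n ℂ} (hD : D.PosDef) :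
    (fromBlocks A B Bᴴ D).PosDef ↔ (A - B * D⁻¹ * Bᴴ).PosDef := by
  have : Invertible D := hD.isUnit.invertible
  have hiff := PosDef.fromBlocks₂₂ A B hD
  have hdet : (fromBlocks A B Bᴴ D).det ≠ 0 ↔ (A - B * D⁻¹ * Bᴴ).det ≠ 0 := by
    rw [det_fromBlocks₂₂, invOf_eq_nonsing_inv]
    simp [hD.det_pos.ne']
  constructor
  · exact fun h => (hiff.1 h.posSemidef).posDef_iff_det_ne_zero.2
      (hdet.1 (h.posSemidef.posDef_iff_det_ne_zero.1 h))
  · exact fun h => (hiff.2 h.posSemidef).posDef_iff_det_ne_zero.2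
      (hdet.2 (h.posSemidef.posDef_iff_det_ne_zero.1 h))

theorem star_dotProduct_conjTranspose_mul_self {n : ℕ} (A : Matrix (Fin n) (Fin n) ℂ)
    (v : EuclideanSpace ℂ (Fin n)) :
    star v.ofLp ⬝ᵥ ((Aᴴ * A) *ᵥ v.ofLp) =
      ((‖toEuclideanCLM (n := Fin n) (𝕜 := ℂ) A v‖ ^ 2 : ℝ) : ℂ) := by
  rw [EuclideanSpace.norm_sq_eq, ← mulVec_mulVec, dotProduct_mulVec, vecMul_conjTranspose,
    star_star, dotProduct]
  push_cast
  refine Finset.sum_congr rfl fun i _ => ?_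
  rw [← Complex.conj_mul']
  rfl

theorem posSemidef_sub_iff_norm_le {n : ℕ} (S N : Matrix (Fin n) (Fin n) ℂ) :
    (Sᴴ * S - Nᴴ * N).PosSemidef ↔ ∀ v, ‖toEuclideanCLM (n := Fin n) (𝕜 := ℂ) N v‖ ≤
      ‖toEuclideanCLM (n := Fin n) (𝕜 := ℂ) S v‖ := by
  have hH : (Sᴴ * S - Nᴴ * N).IsHermitian :=
    (isHermitian_conjTranspose_mul_self S).sub (isHermitian_conjTranspose_mul_self N)
  rw [posSemidef_iff_dotProduct_mulVec]
  have key : ∀ v : EuclideanSpace ℂ (Fin n),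
      0 ≤ star v.ofLp ⬝ᵥ ((Sᴴ * S - Nᴴ * N) *ᵥ v.ofLp) ↔
        ‖toEuclideanCLM (n := Fin n) (𝕜 := ℂ) N v‖ ≤
          ‖toEuclideanCLM (n := Fin n) (𝕜 := ℂ) S v‖ := fun v => by
    rw [sub_mulVec, dotProduct_sub, star_dotProduct_conjTranspose_mul_self,
      star_dotProduct_conjTranspose_mul_self, sub_nonneg, Complex.real_le_real,
      sq_le_sq₀ (norm_nonneg _) (norm_nonneg _)]
  exact ⟨fun h v => (key v).1 (h.2 _), fun h => ⟨hH, fun v => (key (WithLp.toLp 2 v)).2 (h _)⟩⟩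

theorem posDef_sub_iff_norm_lt {n : ℕ} (S N : Matrix (Fin n) (Fin n) ℂ) :
    (Sᴴ * S - Nᴴ * N).PosDef ↔ ∀ v, v ≠ 0 → ‖toEuclideanCLM (n := Fin n) (𝕜 := ℂ) N v‖ <
      ‖toEuclideanCLM (n := Fin n) (𝕜 := ℂ) S v‖ := by
  have hH : (Sᴴ * S - Nᴴ * N).IsHermitian :=
    (isHermitian_conjTranspose_mul_self S).sub (isHermitian_conjTranspose_mul_self N)
  rw [posDef_iff_dotProduct_mulVec]
  have key : ∀ v : EuclideanSpace ℂ (Fin n),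
      0 < star v.ofLp ⬝ᵥ ((Sᴴ * S - Nᴴ * N) *ᵥ v.ofLp) ↔
        ‖toEuclideanCLM (n := Fin n) (𝕜 := ℂ) N v‖ <
          ‖toEuclideanCLM (n := Fin n) (𝕜 := ℂ) S v‖ := fun v => by
    rw [sub_mulVec, dotProduct_sub, star_dotProduct_conjTranspose_mul_self,
      star_dotProduct_conjTranspose_mul_self, sub_pos, Complex.real_lt_real,
      sq_lt_sq₀ (norm_nonneg _) (norm_nonneg _)]
  refine ⟨fun h v hv => (key v).1 (h.2 ?_), fun h => ⟨hH, fun {v} hv =>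
    (key (WithLp.toLp 2 v)).2 (h _ ?_)⟩⟩
  · simpa using hv
  · simpa using hv

/-- The factorization lemma of Douglas for square matrices. -/
theorem posSemidef_sub_iff_exists_contraction {n : ℕ} (S N : Matrix (Fin n) (Fin n) ℂ) :
    (Sᴴ * S - Nᴴ * N).PosSemidef ↔
      ∃ K : Matrix (Fin n) (Fin n) ℂ, opNorm K ≤ 1 ∧ N = K * S := by
  rw [posSemidef_sub_iff_norm_le]
  constructor
  · intro h
    set s : EuclideanSpace ℂ (Fin n) →L[ℂ] EuclideanSpace ℂ (Fin n) :=
      toEuclideanCLM (n := Fin n) (𝕜 := ℂ) S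
    set t : EuclideanSpace ℂ (Fin n) →L[ℂ] EuclideanSpace ℂ (Fin n) :=
      toEuclideanCLM (n := Fin n) (𝕜 := ℂ) N
    set R := LinearMap.range s.toLinearMap
    obtain ⟨r, hr⟩ : ∃ r : R →ₗ[ℂ] EuclideanSpace ℂ (Fin n), ∀ y : R, s (r y) = y := by
      obtain ⟨r, hr⟩ := s.toLinearMap.rangeRestrict.exists_rightInverse_of_surjective
        (LinearMap.range_rangeRestrict _)
      exact ⟨r, fun y => congrArg Subtype.val (LinearMap.congr_fun hr y)⟩
    -- `k` sends `S v` to `N v` and vanishes on the orthogonal complement of the range of `S`.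
    set k : EuclideanSpace ℂ (Fin n) →L[ℂ] EuclideanSpace ℂ (Fin n) :=
      t ∘L (LinearMap.toContinuousLinearMap r) ∘L R.orthogonalProjectionOnto
    refine ⟨(toEuclideanCLM (n := Fin n) (𝕜 := ℂ)).symm k, ?_, ?_⟩
    · rw [opNorm, StarAlgEquiv.apply_symm_apply]
      refine k.opNorm_le_bound zero_le_one fun y => ?_
      calc ‖k y‖ ≤ ‖s (r (R.orthogonalProjectionOnto y))‖ := h _
        _ = ‖R.orthogonalProjectionOnto y‖ := by rw [hr]; rfl
        _ ≤ 1 * ‖y‖ := by rw [one_mul]; exact R.norm_orthogonalProjectionOnto_apply_le y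
    · apply (toEuclideanCLM (n := Fin n) (𝕜 := ℂ)).injective
      change t = toEuclideanCLM (n := Fin n) (𝕜 := ℂ) (_ * S)
      rw [map_mul, StarAlgEquiv.apply_symm_apply]
      ext1 v
      have hp : R.orthogonalProjectionOnto (s v) = ⟨s v, LinearMap.mem_range_self _ v⟩ :=
        R.orthogonalProjectionOnto_mem_subspace_eq_self ⟨s v, LinearMap.mem_range_self _ v⟩
      -- This vector lies in the kernel of `S`, hence in that of `N`, so the choice of preimage `r`
      -- is harmless.
      have h0 := h (v - r (R.orthogonalProjectionOnto (s v)))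
      rw [map_sub s, hr, hp, sub_self, norm_zero, norm_le_zero_iff, map_sub, sub_eq_zero, ← hp] at h0
      exact h0
  · rintro ⟨K, hK, rfl⟩ v
    rw [map_mul]
    exact ((toEuclideanCLM (n := Fin n) (𝕜 := ℂ) K).le_opNorm _).trans
      (mul_le_of_le_one_left (norm_nonneg _) hK)

/-- Invertibility of `S` forces `K = N S⁻¹`. A strict inequality at each vector becomes a norm below
`1` because the norm is attained on the compact unit ball. -/
theorem posDef_sub_iff_exists_strict_contraction {n : ℕ} {S : Matrix (Fin n) (Fin n) ℂ}
    (hS : IsUnit S) (N : Matrix (Fin n) (Fin n) ℂ) :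
    (Sᴴ * S - Nᴴ * N).PosDef ↔
      ∃ K : Matrix (Fin n) (Fin n) ℂ, opNorm K < 1 ∧ N = K * S := by
  have hdet := (isUnit_iff_isUnit_det S).1 hS
  rw [posDef_sub_iff_norm_lt]
  constructor
  · intro h
    refine ⟨N * S⁻¹, ?_, by rw [nonsing_inv_mul_cancel_right _ _ hdet]⟩
    set k := toEuclideanCLM (n := Fin n) (𝕜 := ℂ) (N * S⁻¹) with hk
    have hlt : ∀ y, y ≠ 0 → ‖k y‖ < ‖y‖ := by
      intro y hy
      have h1 : toEuclideanCLM (n := Fin n) (𝕜 := ℂ) S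
          (toEuclideanCLM (n := Fin n) (𝕜 := ℂ) S⁻¹ y) = y := by
        rw [← mul_apply_eq_comp, ← map_mul, mul_nonsing_inv _ hdet, map_one]; rfl
      have h2 := h (toEuclideanCLM (n := Fin n) (𝕜 := ℂ) S⁻¹ y) (by
        rintro h0; rw [h0, map_zero] at h1; exact hy h1.symm)
      rw [h1] at h2
      rw [hk, map_mul]
      exact h2
    obtain ⟨y, hy, hmax⟩ := (isCompact_closedBall (0 : EuclideanSpace ℂ (Fin n)) 1).exists_isMaxOn
      ⟨0, by simp⟩ (k.continuous.norm.continuousOn)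
    have hle : ‖k‖ ≤ ‖k y‖ := by
      refine ContinuousLinearMap.opNorm_le_of_unit_norm (norm_nonneg _) fun x hx => hmax ?_
      simp [hx]
    refine hle.trans_lt ?_
    by_cases hy0 : y = 0
    · simp [hy0]
    · exact (hlt y hy0).trans_le (by simpa using hy)
  · rintro ⟨K, hK, rfl⟩ v hv
    rw [map_mul]
    have hne : toEuclideanCLM (n := Fin n) (𝕜 := ℂ) S v ≠ 0 := by
      intro h0
      apply hv
      have : toEuclideanCLM (n := Fin n) (𝕜 := ℂ) (S⁻¹ * S) v = 0 := by
        rw [map_mul, mul_apply_eq_comp, h0, map_zero]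
      rwa [nonsing_inv_mul _ hdet, map_one] at this
    exact ((toEuclideanCLM (n := Fin n) (𝕜 := ℂ) K).le_opNorm _).trans_lt
      (mul_lt_of_lt_one_left (norm_pos_iff.2 hne) hK)

/-! ### The matrix `gap`, its relation to `P_x`, and the completed square. -/

/-- The Pick matrix of the constrained problem with prescribed value `x` at the origin. -/
noncomputable def gap {n : ℕ} (z w : Fin n → ℂ) (x : ℂ) : Matrix (Fin n) (Fin n) ℂ :=
  tangentialPick z (fun i => z i ^ 2 * (1 - conj x * w i)) (fun i => w i - x)

variable {n : ℕ} {z w : Fin n → ℂ}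

theorem mul_conjTranspose_col_apply {l m : Type*} (C : Matrix l (Fin 1) ℂ)
    (D : Matrix m (Fin 1) ℂ) (i : l) (j : m) :
    (C * Dᴴ) i j = C i 0 * conj (D j 0) := by
  simp [Matrix.mul_apply]

theorem matZ_conj_apply (M : Matrix (Fin n) (Fin n) ℂ) (i j : Fin n) :
    (matZ z * M * (matZ z)ᴴ) i j = z i * M i j * conj (z j) := by
  rw [matZ, diagonal_conjTranspose, mul_diagonal, diagonal_mul]
  rfl

theorem Delta_apply (i j : Fin n) : Delta z w i j =
    pick z w i j + w i * conj (w j) * (1 + z i * conj (z j)) := by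
  rw [Delta, Matrix.mul_assoc (matZ z), Matrix.add_apply, Matrix.add_apply, matZ_conj_apply,
    mul_conjTranspose_col_apply]
  simp only [colW, of_apply]
  ring

theorem crossEW_apply (i j : Fin n) :
    crossEW z w i j = conj (w j) * (1 + z i * conj (z j)) := by
  rw [crossEW, Matrix.mul_assoc (matZ z), Matrix.add_apply, matZ_conj_apply,
    mul_conjTranspose_col_apply]
  simp only [colW, colE, of_apply]
  ring

theorem conjTranspose_crossEW : (crossEW z w)ᴴ = crossWE z w := by
  simp [crossEW, crossWE, Matrix.mul_assoc]

/-- The polarized Möbius identity `(wᵢ - x)(w̄ⱼ - x̄) = (1 - x̄ wᵢ)(1 - x w̄ⱼ) - (1 - |x|²)(1 - wᵢ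
w̄ⱼ)`, together with `(1 - t²)/(1 - t) = 1 + t` at `t = zᵢ z̄ⱼ`. -/
theorem gap_eq_smul_pick_sub (hz : ∀ i, ‖z i‖ < 1) (x : ℂ) :
    gap z w x = (1 - x * conj x) • pick z w - (of fun i j =>
      (1 - w i * conj x) * (1 - conj (w j) * x) * (1 + z i * conj (z j))) := by
  ext i j
  have h := one_sub_mul_conj_ne_zero (hz j) (hz i)
  simp [gap, tangentialPick, pick]
  field_simp
  ring

/-- Completing the square: `gap` is quadratic in `x` with `-|x|² Δ` as its top term, and `Δ̃` is
what remains at the centre `Δ⁻¹ (E W* + Z E W* Z*)`. -/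
theorem DeltaTilde_sub_eq_gap (hz : ∀ i, ‖z i‖ < 1) (hΔ : (Delta z w).PosDef) (x : ℂ) :
    DeltaTilde z w - (conj x • (1 : Matrix (Fin n) (Fin n) ℂ) - (Delta z w)⁻¹ * crossEW z w)ᴴ *
      Delta z w * (conj x • (1 : Matrix (Fin n) (Fin n) ℂ) - (Delta z w)⁻¹ * crossEW z w) =
      gap z w x := by
  have hdet := (isUnit_iff_isUnit_det _).1 hΔ.isUnit
  have h1 : (conj x • (1 : Matrix (Fin n) (Fin n) ℂ) - (Delta z w)⁻¹ * crossEW z w)ᴴ *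
      Delta z w = x • Delta z w - crossWE z w := by
    rw [conjTranspose_sub, conjTranspose_mul, conjTranspose_nonsing_inv, hΔ.isHermitian.eq,
      conjTranspose_crossEW, Matrix.sub_mul, nonsing_inv_mul_cancel_right _ _ hdet]
    simp
  have h2 : (x • Delta z w - crossWE z w) * (conj x • (1 : Matrix (Fin n) (Fin n) ℂ) -
      (Delta z w)⁻¹ * crossEW z w) = (x * conj x) • Delta z w - conj x • crossWE z w -
        x • crossEW z w + crossWE z w * (Delta z w)⁻¹ * crossEW z w := by
    rw [Matrix.mul_sub, Matrix.sub_mul _ _ (_ * _), Matrix.smul_mul,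
      mul_nonsing_inv_cancel_left _ _ hdet, Matrix.mul_smul, Matrix.mul_one, smul_sub, smul_smul, Matrix.mul_assoc, mul_comm x]
    abel
  rw [h1, h2, gap_eq_smul_pick_sub hz, DeltaTilde, ← conjTranspose_crossEW,
    Matrix.mul_assoc (matZ z)]
  ext i j
  simp only [Matrix.sub_apply, Matrix.add_apply, Matrix.smul_apply, Delta_apply,
    conjTranspose_apply, crossEW_apply, of_apply, smul_eq_mul, matZ_conj_apply,
    mul_conjTranspose_col_apply, colE]
  simp only [starRingEnd_apply, star_mul', star_add, star_one, star_star]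
  ring

/-- `A - B Bᴴ` is the Schur complement of the bottom identity block, and `L Lᴴ` is the term needed
to eliminate the next block. -/
theorem pickX_eq (z w : Fin n → ℂ) (x : ℂ) :
    ∃ (A : Matrix (Fin n ⊕ (Fin 1 ⊕ Fin 1)) (Fin n ⊕ (Fin 1 ⊕ Fin 1)) ℂ)
      (B : Matrix (Fin n ⊕ (Fin 1 ⊕ Fin 1)) (Fin 1 ⊕ Fin 1) ℂ)
      (L : Matrix (Fin n) (Fin 1 ⊕ Fin 1) ℂ), pickX z w x = fromBlocks A B Bᴴ 1 ∧
        A - B * Bᴴ = fromBlocks (pick z w) L Lᴴ ((1 - x * conj x) • 1) ∧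
        L * Lᴴ = of fun i j =>
          (1 - w i * conj x) * (1 - conj (w j) * x) * (1 + z i * conj (z j)) := by
  obtain ⟨X, hX⟩ : ∃ X : Matrix (Fin 1) (Fin 1) ℂ, X = of fun _ _ => x := ⟨_, rfl⟩
  obtain ⟨N, hN⟩ : ∃ N : Matrix (Fin n) (Fin 1) ℂ, N = colE n - colW w * Xᴴ := ⟨_, rfl⟩
  have hXX : X * Xᴴ = (x * conj x) • 1 := by
    ext i j
    rw [Subsingleton.elim j i]
    simp [hX, Matrix.mul_apply]
  have hNH : (colE n)ᴴ - X * (colW w)ᴴ = Nᴴ := by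
    simp [hN]
  have hBH : (fromRows 0 (fromBlocks X 0 0 X) :
      Matrix (Fin n ⊕ (Fin 1 ⊕ Fin 1)) (Fin 1 ⊕ Fin 1) ℂ)ᴴ =
        fromCols 0 (fromBlocks Xᴴ 0 0 Xᴴ) := by
    simp [conjTranspose_fromRows_eq_fromCols_conjTranspose, fromBlocks_conjTranspose]
  refine ⟨fromBlocks (pick z w) (fromCols N (matZ z * N)) (fromRows Nᴴ (Nᴴ * (matZ z)ᴴ)) 1,
    fromRows 0 (fromBlocks X 0 0 X), fromCols N (matZ z * N), ?_, ?_, ?_⟩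
  · rw [hBH, ← hNH, hN, ← fromBlocks_one, hX]
    rfl
  · rw [hBH, conjTranspose_fromCols_eq_fromRows_conjTranspose, conjTranspose_mul,
      fromRows_mul_fromCols, fromBlocks_multiply, sub_eq_add_neg, fromBlocks_neg, fromBlocks_add]
    simp only [Matrix.zero_mul, Matrix.mul_zero, neg_zero, add_zero, zero_add, hXX]
    congr 1
    rw [← sub_eq_add_neg]
    rw [sub_smul, one_smul, ← fromBlocks_one, fromBlocks_smul, smul_zero]
  · rw [conjTranspose_fromCols_eq_fromRows_conjTranspose, fromCols_mul_fromRows,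
      conjTranspose_mul, ← Matrix.mul_assoc, Matrix.mul_assoc (matZ z)]
    ext i j
    rw [Matrix.add_apply, matZ_conj_apply, mul_conjTranspose_col_apply]
    have hNi : ∀ i, N i 0 = 1 - w i * conj x := fun i => by
      rw [hN, Matrix.sub_apply, mul_conjTranspose_col_apply, hX]
      rfl
    rw [hNi, hNi]
    simp only [of_apply, map_sub, map_mul, map_one, Complex.conj_conj]
    ring

theorem pickX_posSemidef_iff (hz : ∀ i, ‖z i‖ < 1) {x : ℂ} (hx : ‖x‖ < 1) :
    ((pickX z w x).PosSemidef ↔ (gap z w x).PosSemidef) ∧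
      ((pickX z w x).PosDef ↔ (gap z w x).PosDef) := by
  obtain ⟨A, B, L, h1, h2, h3⟩ := pickX_eq z w x
  have hpos := one_sub_mul_conj_self_pos hx
  have hone : (1 : Matrix (Fin 1 ⊕ Fin 1) (Fin 1 ⊕ Fin 1) ℂ).PosDef := PosDef.one
  have hD : ((1 - x * conj x) • (1 : Matrix (Fin 1 ⊕ Fin 1) (Fin 1 ⊕ Fin 1) ℂ)).PosDef :=
    hone.smul hpos
  have hDinv : ((1 - x * conj x) • (1 : Matrix (Fin 1 ⊕ Fin 1) (Fin 1 ⊕ Fin 1) ℂ))⁻¹ =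
      (1 - x * conj x)⁻¹ • 1 := by
    apply inv_eq_right_inv
    rw [smul_mul_smul_comm, mul_inv_cancel₀ hpos.ne', Matrix.mul_one, one_smul]
  have hgap : pick z w - L * ((1 - x * conj x) • (1 : Matrix (Fin 1 ⊕ Fin 1) (Fin 1 ⊕ Fin 1) ℂ))⁻¹
      * Lᴴ = (1 - x * conj x)⁻¹ • gap z w x := by
    rw [hDinv, gap_eq_smul_pick_sub hz, ← h3, smul_sub, inv_smul_smul₀ hpos.ne', Matrix.mul_smul,
      Matrix.mul_one, Matrix.smul_mul]
  have hB : A - B * (1 : Matrix (Fin 1 ⊕ Fin 1) (Fin 1 ⊕ Fin 1) ℂ)⁻¹ * Bᴴ =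
      fromBlocks (pick z w) L Lᴴ ((1 - x * conj x) • 1) := by
    rw [inv_one, Matrix.mul_one, h2]
  have : Invertible (1 : Matrix (Fin 1 ⊕ Fin 1) (Fin 1 ⊕ Fin 1) ℂ) := hone.isUnit.invertible
  have : Invertible ((1 - x * conj x) • (1 : Matrix (Fin 1 ⊕ Fin 1) (Fin 1 ⊕ Fin 1) ℂ)) :=
    hD.isUnit.invertible
  have hinv := inv_pos.2 hpos
  constructor
  · rw [h1, PosDef.fromBlocks₂₂ A B hone, hB, PosDef.fromBlocks₂₂ _ L hD, hgap]
    exact ⟨fun h => by simpa [hpos.ne'] using h.smul hpos.le, fun h => h.smul hinv.le⟩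
  · rw [h1, posDef_fromBlocks₂₂_iff A B hone, hB, posDef_fromBlocks₂₂_iff _ L hD, hgap]
    exact ⟨fun h => by simpa [hpos.ne'] using h.smul hpos, fun h => h.smul hinv⟩

theorem gap_eq_sub (hz : ∀ i, ‖z i‖ < 1) (hΔ : (Delta z w).PosDef)
    (hT : (DeltaTilde z w).PosSemidef) (x : ℂ) :
    gap z w x = (CFC.sqrt (DeltaTilde z w))ᴴ * CFC.sqrt (DeltaTilde z w) -
      (CFC.sqrt (Delta z w) * (conj x • (1 : Matrix (Fin n) (Fin n) ℂ) -
        (Delta z w)⁻¹ * crossEW z w))ᴴ *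
      (CFC.sqrt (Delta z w) * (conj x • (1 : Matrix (Fin n) (Fin n) ℂ) -
        (Delta z w)⁻¹ * crossEW z w)) := by
  have h1 : ∀ M : Matrix (Fin n) (Fin n) ℂ, (CFC.sqrt M)ᴴ = CFC.sqrt M := fun M =>
    (nonneg_iff_posSemidef.1 (CFC.sqrt_nonneg M)).isHermitian
  rw [conjTranspose_mul, h1, h1, CFC.sqrt_mul_sqrt_self _ (nonneg_iff_posSemidef.2 hT),
    Matrix.mul_assoc, ← Matrix.mul_assoc (CFC.sqrt (Delta z w)),
    CFC.sqrt_mul_sqrt_self _ (nonneg_iff_posSemidef.2 hΔ.posSemidef), ← Matrix.mul_assoc,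
    DeltaTilde_sub_eq_gap hz hΔ]

theorem isUnit_sqrt {M : Matrix (Fin n) (Fin n) ℂ} (hM : M.PosDef) : IsUnit (CFC.sqrt M) := by
  have h : CFC.sqrt M * CFC.sqrt M = M :=
    CFC.sqrt_mul_sqrt_self _ (nonneg_iff_posSemidef.2 hM.posSemidef)
  have hM' := hM.isUnit
  rw [isUnit_iff_isUnit_det] at hM' ⊢
  rw [← h, det_mul] at hM'
  exact isUnit_of_mul_isUnit_left hM'

theorem smul_one_eq_ballPoint_iff (hΔ : (Delta z w).PosDef) (c : ℂ)
    (K : Matrix (Fin n) (Fin n) ℂ) :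
    c • (1 : Matrix (Fin n) (Fin n) ℂ) = ballPoint z w K ↔
      CFC.sqrt (Delta z w) * (c • (1 : Matrix (Fin n) (Fin n) ℂ) -
        (Delta z w)⁻¹ * crossEW z w) = K * CFC.sqrt (DeltaTilde z w) := by
  have h := (isUnit_iff_isUnit_det _).1 (isUnit_sqrt hΔ)
  rw [ballPoint, ← sub_eq_iff_eq_add', Matrix.mul_assoc]
  constructor
  · intro h1
    rw [h1, mul_nonsing_inv_cancel_left _ _ h]
  · intro h1
    rw [← h1, nonsing_inv_mul_cancel_left _ _ h]

theorem gap_posSemidef_iff (hz : ∀ i, ‖z i‖ < 1) (hΔ : (Delta z w).PosDef)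
    (hT : (DeltaTilde z w).PosSemidef) (x : ℂ) :
    (gap z w x).PosSemidef ↔ ∃ K : Matrix (Fin n) (Fin n) ℂ, opNorm K ≤ 1 ∧
      conj x • (1 : Matrix (Fin n) (Fin n) ℂ) = ballPoint z w K := by
  simp_rw [smul_one_eq_ballPoint_iff hΔ]
  rw [gap_eq_sub hz hΔ hT, posSemidef_sub_iff_exists_contraction]

theorem gap_posDef_iff (hz : ∀ i, ‖z i‖ < 1) (hΔ : (Delta z w).PosDef)
    (hT : (DeltaTilde z w).PosDef) (x : ℂ) :
    (gap z w x).PosDef ↔ ∃ K : Matrix (Fin n) (Fin n) ℂ, opNorm K < 1 ∧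
      conj x • (1 : Matrix (Fin n) (Fin n) ℂ) = ballPoint z w K := by
  simp_rw [smul_one_eq_ballPoint_iff hΔ]
  rw [gap_eq_sub hz hΔ hT.posSemidef, posDef_sub_iff_exists_strict_contraction (isUnit_sqrt hT)]

/-- `Δ̃` is `gap` plus the positive semidefinite term `Tᴴ Δ T`. -/
theorem DeltaTilde_posSemidef_of_gap (hz : ∀ i, ‖z i‖ < 1) (hΔ : (Delta z w).PosDef) (x : ℂ) :
    ((gap z w x).PosSemidef → (DeltaTilde z w).PosSemidef) ∧
      ((gap z w x).PosDef → (DeltaTilde z w).PosDef) := by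
  have h := sub_eq_iff_eq_add.1 (DeltaTilde_sub_eq_gap hz hΔ x)
  have h2 := hΔ.posSemidef.conjTranspose_mul_mul_same
    (conj x • (1 : Matrix (Fin n) (Fin n) ℂ) - (Delta z w)⁻¹ * crossEW z w)
  rw [h]
  exact ⟨fun h1 => h1.add h2, fun h1 => h1.add_posSemidef h2⟩

/-! ### From constrained interpolation to `gap` and back. -/

/-- Dividing twice at the origin, a constrained Schur function yields a Schur function solving the
tangential problem with Pick matrix `gap`. -/
theorem posSemidef_gap_of_constrainedSchur (hz : ∀ i, ‖z i‖ < 1) {s : ℂ → ℂ}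
    (hs : ConstrainedSchur s) (h0 : ‖s 0‖ < 1) (hw : ∀ i, s (z i) = w i) :
    (gap z w (s 0)).PosSemidef := by
  have hs' : IsSchur s := ⟨hs.1, hs.2.1⟩
  obtain ⟨f, hf, hfs⟩ := hs'.exists_division (a := 0) (by simp) h0
  simp only [map_zero, zero_mul, sub_zero, div_one] at hfs
  have hnhds : Metric.ball (0 : ℂ) 1 ∈ nhds 0 := Metric.ball_mem_nhds _ one_pos
  -- Differentiating `s - s(0) = (1 - conj(s(0)) s) ζ f` at `0` gives `s'(0) = (1 - |s(0)|²) f(0)`,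
  -- so the constraint lets `f` be divided by `ζ` again.
  have hf0 : f 0 = 0 := by
    have hds : HasDerivAt s 0 0 := by
      simpa [hs.2.2] using (hs.1.differentiableAt hnhds).hasDerivAt
    have hdf := (hf.1.differentiableAt hnhds).hasDerivAt
    have h1 := (((hds.const_mul (conj (s 0))).const_sub 1).mul (hasDerivAt_id 0)).mul hdf
    have h2 := (hds.sub_const (s 0)).congr_of_eventuallyEq (f₁ :=
        ((fun y => 1 - conj (s 0) * s y) * _root_.id) * f) (by
      filter_upwards [hnhds] with ζ hζ
      exact (hfs ζ (mem_ball_zero_iff.1 hζ)).symm)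
    have h3 := h1.unique h2
    simp only [Pi.mul_apply, id_eq, mul_zero, zero_mul, mul_one, add_zero, neg_zero,
      zero_add] at h3
    exact (mul_eq_zero.1 h3).resolve_left (one_sub_conj_mul_ne_zero h0 h0.le)
  obtain ⟨g, hg, hgf⟩ := hf.exists_division (a := 0) (by simp) (by simp [hf0])
  simp only [hf0, map_zero, zero_mul, sub_zero, div_one, one_mul] at hgf
  refine hg.posSemidef_tangentialPick hz fun i => ?_
  have h1 := hfs _ (hz i)
  rw [hgf _ (hz i), hw] at h1
  rw [h1]
  ring

theorem exists_constrainedSchur_of_posSemidef_gap (hz : ∀ i, ‖z i‖ < 1) {x : ℂ} (hx : ‖x‖ < 1)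
    (h : (gap z w x).PosSemidef) : Solvable z w := by
  obtain ⟨g, hg, hgw⟩ := exists_isSchur_of_posSemidef_tangentialPick hz h
  have hx' : ‖-x‖ < 1 := by rwa [norm_neg]
  -- The solution is `(ζ² g + x) / (1 + x̄ ζ² g)`; the double zero of `ζ² g` at `0` gives the
  -- vanishing derivative.
  have hm := (IsSchur.id.mul IsSchur.id).mul hg
  have hs := hm.moebius hx'
  refine ⟨_, ⟨hs.1, hs.2, ?_⟩, fun i => ?_⟩
  · have hdg := (hg.1.differentiableAt (Metric.ball_mem_nhds (0 : ℂ) one_pos)).hasDerivAt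
    have hd : HasDerivAt (fun ζ => ζ * ζ * g ζ) 0 0 := by
      simpa using ((hasDerivAt_id' (0 : ℂ)).fun_mul (hasDerivAt_id' 0)).fun_mul hdg
    have := (hd.sub_const (-x)).fun_div ((hd.const_mul (conj (-x))).const_sub 1) (by simp)
    simpa using this.deriv
  · have hne := one_sub_conj_mul_ne_zero hx' (hm.2 _ (mem_ball_zero_iff.2 (hz i)))
    rw [div_eq_iff hne, map_neg]
    linear_combination -hgw i

/-- If `|x| ≥ 1`, the Möbius identity gives `|1 - x̄ wᵢ| ≤ |wᵢ - x|`, while the diagonal entry gives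
`|wᵢ - x| ≤ |zᵢ|² |1 - x̄ wᵢ|`. Both sides vanish, so `wᵢ = x`, which is impossible. -/
theorem norm_lt_one_of_posSemidef_gap (hz : ∀ i, ‖z i‖ < 1) (hw : ∀ i, ‖w i‖ < 1) (i : Fin n)
    {x : ℂ} (h : (gap z w x).PosSemidef) : ‖x‖ < 1 := by
  have h1 := norm_le_of_posSemidef_tangentialPick (hz i) h
  rw [norm_mul, norm_pow] at h1
  have h2 := normSq_moebius x (w i)
  by_contra! hx
  have hw2 : 0 < 1 - ‖w i‖ ^ 2 := by nlinarith [norm_nonneg (w i), hw i]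
  have hx2 : (1 - ‖x‖ ^ 2) * (1 - ‖w i‖ ^ 2) ≤ 0 :=
    mul_nonpos_of_nonpos_of_nonneg (by nlinarith) hw2.le
  have hz2 : ‖z i‖ ^ 2 < 1 := pow_lt_one₀ (norm_nonneg _) (hz i) two_ne_zero
  have h3 : ‖1 - conj x * w i‖ ≤ ‖w i - x‖ :=
    (sq_le_sq₀ (norm_nonneg _) (norm_nonneg _)).1 (by linarith)
  have h4 : ‖1 - conj x * w i‖ = 0 := by nlinarith [norm_nonneg (1 - conj x * w i)]
  have h5 : ‖w i - x‖ = 0 := le_antisymm (by simpa [h4] using h1) (norm_nonneg _)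
  rw [norm_eq_zero, sub_eq_zero] at h5
  exact (hw i).not_ge (h5 ▸ hx)

theorem solvable_iff_exists_gap (hz : ∀ i, ‖z i‖ < 1) (hw : ∀ i, ‖w i‖ < 1) :
    Solvable z w ↔ ∃ x, (gap z w x).PosSemidef := by
  -- Excluding `|x| ≥ 1` needs a node, so the empty problem is settled separately.
  rcases n.eq_zero_or_pos with rfl | hn
  · refine ⟨fun _ => ⟨0, ?_⟩, fun _ => ⟨fun _ => 0, ⟨differentiableOn_const 0, by simp, by simp⟩,
      fun i => i.elim0⟩⟩
    rw [Subsingleton.elim (gap z w 0) 0]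
    exact PosSemidef.zero
  constructor
  · rintro ⟨s, hs, hsw⟩
    refine ⟨s 0, posSemidef_gap_of_constrainedSchur hz hs ?_ hsw⟩
    by_contra! h
    have h1 := IsSchur.eq_const ⟨hs.1, hs.2.1⟩ (a := 0) (by simp) h (hz ⟨0, hn⟩)
    rw [hsw] at h1
    exact (hw ⟨0, hn⟩).not_ge (h1 ▸ h)
  · rintro ⟨x, hx⟩
    exact exists_constrainedSchur_of_posSemidef_gap hz
      (norm_lt_one_of_posSemidef_gap hz hw ⟨0, hn⟩ hx) hx

end CNP

theorem theorem4p3 (n : ℕ) (z w : Fin n → ℂ)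
    (hz : ∀ i, ‖z i‖ < 1) (hz_inj : Function.Injective z) (hw : ∀ i, ‖w i‖ < 1)
    (hΔ : (CNP.Delta z w).PosDef) :
    -- solvability criterion
    (CNP.Solvable z w ↔
      (CNP.DeltaTilde z w).PosSemidef ∧
        ∃ K : Matrix (Fin n) (Fin n) ℂ, CNP.opNorm K ≤ 1 ∧
          ∃ c : ℂ, CNP.ballPoint z w K = c • (1 : Matrix (Fin n) (Fin n) ℂ)) ∧
    -- positive semidefinite Pick matrices
    ((CNP.DeltaTilde z w).PosSemidef → ∀ x : ℂ, ‖x‖ < 1 →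
      ((CNP.pickX z w x).PosSemidef ↔
        ∃ K : Matrix (Fin n) (Fin n) ℂ, CNP.opNorm K ≤ 1 ∧
          (starRingEnd ℂ x) • (1 : Matrix (Fin n) (Fin n) ℂ) = CNP.ballPoint z w K)) ∧
    -- positive definite Pick matrices
    ((∃ x : ℂ, ‖x‖ < 1 ∧ (CNP.pickX z w x).PosDef) → (CNP.DeltaTilde z w).PosDef) ∧
    ((CNP.DeltaTilde z w).PosDef → ∀ x : ℂ, ‖x‖ < 1 →
      ((CNP.pickX z w x).PosDef ↔
        ∃ K : Matrix (Fin n) (Fin n) ℂ, CNP.opNorm K < 1 ∧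
          (starRingEnd ℂ x) • (1 : Matrix (Fin n) (Fin n) ℂ) = CNP.ballPoint z w K)) := by
  refine ⟨?_, fun hT x hx => ?_, ?_, fun hT x hx => ?_⟩
  · rw [CNP.solvable_iff_exists_gap hz hw]
    constructor
    · rintro ⟨x, hx⟩
      have hT := (CNP.DeltaTilde_posSemidef_of_gap hz hΔ x).1 hx
      obtain ⟨K, hK, hKx⟩ := (CNP.gap_posSemidef_iff hz hΔ hT x).1 hx
      exact ⟨hT, K, hK, _, hKx.symm⟩
    · rintro ⟨hT, K, hK, c, hc⟩
      -- No bound on `c` is needed: positivity of `gap` already forces `|c| < 1` once there is a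
      -- node.
      exact ⟨starRingEnd ℂ c, (CNP.gap_posSemidef_iff hz hΔ hT _).2
        ⟨K, hK, by rw [Complex.conj_conj, hc]⟩⟩
  · rw [(CNP.pickX_posSemidef_iff hz hx).1]
    exact CNP.gap_posSemidef_iff hz hΔ hT x
  · rintro ⟨x, hx, h⟩
    exact (CNP.DeltaTilde_posSemidef_of_gap hz hΔ x).2 ((CNP.pickX_posSemidef_iff hz hx).2.1 h)
  · rw [(CNP.pickX_posSemidef_iff hz hx).2]
    exact CNP.gap_posDef_iff hz hΔ hT x
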